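/- Let $n,m\ge 0$ be integers, $A\in\mathbb C^{n\times n}$, $B\in\mathbb C^{n\times m}$, let $R\in\mathbb C^{m\times m}$ be Hermitian and nonsingular and $H\in\mathbb C^{n\times n}$ be Hermitian. Let $\overline M$ denote the entrywise conjugate, $M^H$ the conjugate transpose and $\rho(M)$ the spectral radius of $M$. For Hermitian matrices, $M\ge N$ means that $M-N$ is positive semidefinite and $M>0$ means that $M$ is positive definite. For a Hermitian matrix $X\in\mathbb C^{n\times n}$ put $R_X:=R+B^H\overline XB$, and assume that $R_H=R+B^H\overline HB$ is nonsingular. Let $\mathrm{dom}(\mathcal R)$ be the set of Hermitian $X\in\mathbb C^{n\times n}$ with $\det R_X\ne0$, and for $X\in\mathrm{dom}(\mathcal R)$ put $$\mathcal R(X):=A^H\overline XA-A^H\overline XB\,R_X^{-1}B^H\overline XA+H,\qquad F_X:=R_X^{-1}B^H\overline XA,\qquad T_X:=A-BF_X .$$ Define $\mathcal R_\le:=\{X\in\mathrm{dom}(\mathcal R): X\le\mathcal R(X)\}$, $\mathbb P:=\{X\in\mathrm{dom}(\mathcal R): R_X>0\}$, $\mathbb T:=\{X\in\mathrm{dom}(\mathcal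 R):\rho(\overline{T_X}\,T_X)<1\}$ and $\mathbb F:=\{F\in\mathbb C^{m\times n}:\rho(\overline{A-BF}\,(A-BF))<1\}$. With $G:=BR^{-1}B^H$, let $$\widehat A:=\overline AA-\overline AB\,R_H^{-1}B^H\overline HA,\quad \widehat B:=\begin{bmatrix}\overline B&\overline AB\end{bmatrix}\in\mathbb C^{n\times 2m},\quad \widehat R:=\overline R\oplus R_H,\quad \widehat H:=H+A^H\overline H(I+G\overline H)^{-1}A .$$ For Hermitian $X\in\mathbb C^{n\times n}$ put $\widehat R_X:=\widehat R+\widehat B^HX\widehat B$, let $\mathrm{dom}(\widehat{\mathcal R})$ be the set of Hermitian $X\in\mathbb C^{n\times n}$ with $\det\widehat R_X\neq0$, and for $X\in\mathrm{dom}(\widehat{\mathcal R})$ put $$\widehat{\mathcal R}(X):=\widehat A^HX\widehat A-\widehat A^HX\widehat B\,\widehat R_X^{-1}\widehat B^HX\widehat A+\widehat H,\qquad \widehat F_X:=\widehat R_X^{-1}\widehat B^HX\widehat A .$$ Define $\widehat{\mathcal R}_=:=\{X\in\mathrm{dom}(\widehat{\mathcal R}): X=\widehat{\mathcal R}(X)\}$,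 $\widehat{\mathbb P}:=\{X\in\mathrm{dom}(\widehat{\mathcal R}):\widehat R_X>0\}$, $\widehat{\mathbb T}:=\{X\in\mathrm{dom}(\widehat{\mathcal R}):\rho(\widehat A-\widehat B\widehat F_X)<1\}$ and $\widehat{\mathbb F}:=\{\widehat F\in\mathbb C^{2m\times n}:\rho(\widehat A-\widehat B\widehat F)<1\}$. Assume that $\mathcal R_\le\cap\mathbb P\ne\emptyset$. Then the following two statements are equivalent: (i) $\mathbb F\neq\emptyset$; (ii) $\mathbb T\cap\mathbb P\ne\emptyset$. Moreover, if either (i) or (ii) holds, then $\widehat{\mathcal R}_=\cap\widehat{\mathbb P}\neq\emptyset$, and the following two statements also hold: (iii) $\widehat{\mathbb F}\ne\emptyset$, i.e. the pair $(\widehat A,\widehat B)$ is stabilizable; (iv) $\widehat{\mathbb T}\cap\widehat{\mathbb P}\neq\emptyset$. -/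

import Mathlib

open scoped Matrix ComplexOrder

noncomputable section

namespace ConjRiccati

/-- The entrywise complex conjugate of a matrix. -/
def conj {k l : Type*} (M : Matrix k l ℂ) : Matrix k l ℂ := M.map (starRingEnd ℂ)

/-- The condition `ρ(M) < 1` on the spectral radius of a square complex matrix. -/
def SpecRadLtOne {k : Type*} [Fintype k] [DecidableEq k] (M : Matrix k k ℂ) : Prop :=
  spectralRadius ℂ M < 1

/-- The pair `(A, B)` is stabilizable (in discrete time): some state feedback `F` makes all
eigenvalues of `A - B F` lie in the open unit disc. -/
def Stabilizable {k l : Type*} [Fintype k] [DecidableEq k] [Fintype l]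
    (A : Matrix k k ℂ) (B : Matrix k l ℂ) : Prop :=
  ∃ F : Matrix l k ℂ, SpecRadLtOne (A - B * F)

/-- The coefficient matrices of a conjugate discrete-time algebraic Riccati equation. -/
structure Coeffs (n m : ℕ) where
  A : Matrix (Fin n) (Fin n) ℂ
  B : Matrix (Fin n) (Fin m) ℂ
  R : Matrix (Fin m) (Fin m) ℂ
  H : Matrix (Fin n) (Fin n) ℂ

namespace Coeffs

variable {n m : ℕ} (c : Coeffs n m)

/-! The conjugate Riccati equation (CDARE) -/

/-- `G = B R⁻¹ Bᴴ`. -/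
def G : Matrix (Fin n) (Fin n) ℂ := c.B * c.R⁻¹ * c.Bᴴ

/-- `R_X = R + Bᴴ X̄ B`. -/
def RX (X : Matrix (Fin n) (Fin n) ℂ) : Matrix (Fin m) (Fin m) ℂ :=
  c.R + c.Bᴴ * conj X * c.B

/-- The Riccati operator `ℛ(X) = Aᴴ X̄ A - Aᴴ X̄ B (R + Bᴴ X̄ B)⁻¹ Bᴴ X̄ A + H`. -/
def ric (X : Matrix (Fin n) (Fin n) ℂ) : Matrix (Fin n) (Fin n) ℂ :=
  c.Aᴴ * conj X * c.A
    - c.Aᴴ * conj X * c.B * (c.RX X)⁻¹ * c.Bᴴ * conj X * c.A + c.H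

/-- `dom(ℛ)`: the Hermitian `X` with `det R_X ≠ 0`. -/
def dom : Set (Matrix (Fin n) (Fin n) ℂ) := {X | X.IsHermitian ∧ (c.RX X).det ≠ 0}

/-- `ℛ_≤`: the `X ∈ dom(ℛ)` with `X ≤ ℛ(X)`. -/
def ricLe : Set (Matrix (Fin n) (Fin n) ℂ) := {X | X ∈ c.dom ∧ (c.ric X - X).PosSemidef}

/-- `ℙ`: the `X ∈ dom(ℛ)` with `R_X > 0`. -/
def setP : Set (Matrix (Fin n) (Fin n) ℂ) := {X | X ∈ c.dom ∧ (c.RX X).PosDef}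

/-- `F_X = R_X⁻¹ Bᴴ X̄ A`. -/
def FX (X : Matrix (Fin n) (Fin n) ℂ) : Matrix (Fin m) (Fin n) ℂ :=
  (c.RX X)⁻¹ * c.Bᴴ * conj X * c.A

/-- `A_F = A - B F`. -/
def AF (F : Matrix (Fin m) (Fin n) ℂ) : Matrix (Fin n) (Fin n) ℂ := c.A - c.B * F

/-- `T_X = A - B F_X`. -/
def TX (X : Matrix (Fin n) (Fin n) ℂ) : Matrix (Fin n) (Fin n) ℂ := c.A - c.B * c.FX X

/-- `𝕋`: the `X ∈ dom(ℛ)` such that the conjugate product of `T_X` with itself, conj(`T_X`) `T_X`,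
has spectral radius less than one. -/
def setT : Set (Matrix (Fin n) (Fin n) ℂ) :=
  {X | X ∈ c.dom ∧ SpecRadLtOne (conj (c.TX X) * c.TX X)}

/-- `𝔽`: the `F` such that conj(`A - B F`) (`A - B F`) has spectral radius less than one. -/
def setF : Set (Matrix (Fin m) (Fin n) ℂ) :=
  {F | SpecRadLtOne (conj (c.AF F) * c.AF F)}

/-! The transformed Riccati equation (DARE) -/

/-- `Â = Ā A - Ā B R_H⁻¹ Bᴴ H̄ A`. -/
def hatA : Matrix (Fin n) (Fin n) ℂ :=
  conj c.A * c.A - conj c.A * c.B * (c.RX c.H)⁻¹ * c.Bᴴ * conj c.H * c.A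

/-- `B̂ = [B̄, Ā B]`, with `2m` columns. -/
def hatB : Matrix (Fin n) (Fin m ⊕ Fin m) ℂ :=
  Matrix.fromCols (conj c.B) (conj c.A * c.B)

/-- `R̂ = R̄ ⊕ R_H`. -/
def hatR : Matrix (Fin m ⊕ Fin m) (Fin m ⊕ Fin m) ℂ :=
  Matrix.fromBlocks (conj c.R) 0 0 (c.RX c.H)

/-- `Ĥ = H + Aᴴ H̄ (I + G H̄)⁻¹ A`. -/
def hatH : Matrix (Fin n) (Fin n) ℂ :=
  c.H + c.Aᴴ * conj c.H * (1 + c.G * conj c.H)⁻¹ * c.A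

/-- `R̂_X = R̂ + B̂ᴴ X B̂`. -/
def hatRX (X : Matrix (Fin n) (Fin n) ℂ) : Matrix (Fin m ⊕ Fin m) (Fin m ⊕ Fin m) ℂ :=
  c.hatR + c.hatBᴴ * X * c.hatB

/-- The Riccati operator `Âᴴ X Â - Âᴴ X B̂ (R̂ + B̂ᴴ X B̂)⁻¹ B̂ᴴ X Â + Ĥ` of the transformed
equation. -/
def hatRic (X : Matrix (Fin n) (Fin n) ℂ) : Matrix (Fin n) (Fin n) ℂ :=
  c.hatAᴴ * X * c.hatA
    - c.hatAᴴ * X * c.hatB * (c.hatRX X)⁻¹ * c.hatBᴴ * X * c.hatA + c.hatH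

/-- The domain of the transformed Riccati operator: the Hermitian `X` with `det R̂_X ≠ 0`. -/
def hatDom : Set (Matrix (Fin n) (Fin n) ℂ) := {X | X.IsHermitian ∧ (c.hatRX X).det ≠ 0}

/-- The solution set of the transformed equation. -/
def hatRicEq : Set (Matrix (Fin n) (Fin n) ℂ) := {X | X ∈ c.hatDom ∧ X = c.hatRic X}

/-- `ℙ̂`: the `X` in the domain with `R̂_X > 0`. -/
def hatP : Set (Matrix (Fin n) (Fin n) ℂ) := {X | X ∈ c.hatDom ∧ (c.hatRX X).PosDef}

/-- `F̂_X = R̂_X⁻¹ B̂ᴴ X Â`. -/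
def hatFX (X : Matrix (Fin n) (Fin n) ℂ) : Matrix (Fin m ⊕ Fin m) (Fin n) ℂ :=
  (c.hatRX X)⁻¹ * c.hatBᴴ * X * c.hatA

/-- `𝕋̂`: the `X` in the domain such that `Â - B̂ F̂_X` has spectral radius less than one. -/
def hatT : Set (Matrix (Fin n) (Fin n) ℂ) :=
  {X | X ∈ c.hatDom ∧ SpecRadLtOne (c.hatA - c.hatB * c.hatFX X)}

/-- `𝔽̂`: the `2m × n` matrices `F̂` such that `Â - B̂ F̂` has spectral radius less than one. -/
def hatF : Set (Matrix (Fin m ⊕ Fin m) (Fin n) ℂ) :=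
  {F | SpecRadLtOne (c.hatA - c.hatB * F)}

end Coeffs

end ConjRiccati

end

open scoped Matrix ComplexOrder
open Matrix Filter Topology

noncomputable section

namespace ConjRiccati

/-! ### Spectral radius and powers -/

section Spectral

variable {k : Type*} [Fintype k] [DecidableEq k]

/-! Write σ for either the identity or conjugation of `ℂ`. Both Riccati equations concern X ↦
`riccatiMap` (σ X), and the twisted Stein operator D ↦ Tᴴ σ(D) T squares to the ordinary one for
σ(T) T (`conj_stein_twice`). Hence ρ(σ(T) T) < 1 is the right stability notion, and one argument
with a parameter σ serves both equations.

The core is a single policy improvement (`exists_stabilizing`). Given a subsolution X₀ with positive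
definite weight and a stabilizing F, let X be the cost of F, the solution of a Stein equation.
Comparison gives X ≥ X₀, so the weight at X stays positive definite. Completing the square shows
that X is a supersolution, and an eigenvector argument shows that its gain is stabilizing. With σ
conjugation this is (i) → (ii); the converse takes F = F_X.

The transformed equation merges two successive control steps. A two-step dynamic programming
estimate (`second_step_le`) carries X₀ over as a subsolution with positive definite weight
(`posDef_hatRX`, `le_hatRic`), and F gives a feedback with closed loop conj(A_F) A_F
(`hatF_nonempty`). Policy improvement with σ the identity then yields (iii), (iv) and a
supersolution above X₀; a monotone fixed-point argument (`exists_riccati_fixedPoint`) finds a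
solution above X₀. -/

theorem SpecRadLtOne.tendsto_pow {M : Matrix k k ℂ} (h : SpecRadLtOne M) :
    Tendsto (fun n : ℕ => M ^ n) atTop (𝓝 0) := by
  let _ : NormedRing (Matrix k k ℂ) := Matrix.linftyOpNormedRing
  let _ : NormedAlgebra ℂ (Matrix k k ℂ) := Matrix.linftyOpNormedAlgebra
  have : CompleteSpace (Matrix k k ℂ) := FiniteDimensional.complete ℂ _
  obtain ⟨r, hr1, hr2⟩ := ENNReal.lt_iff_exists_nnreal_btwn.1 h
  have hev := (spectrum.pow_nnnorm_pow_one_div_tendsto_nhds_spectralRadius M).eventually_lt_const hr1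
  have hr3 : (r : ℝ) < 1 := by exact_mod_cast hr2
  refine tendsto_zero_iff_norm_tendsto_zero.2 (squeeze_zero'
    (Eventually.of_forall fun n => norm_nonneg _) ?_
    (tendsto_pow_atTop_nhds_zero_of_lt_one r.2 hr3))
  filter_upwards [hev, eventually_gt_atTop 0] with n hn hpos
  have hn' : (‖M ^ n‖₊ : ENNReal) < (r : ENNReal) ^ (n : ℝ) := by
    have := ENNReal.rpow_lt_rpow hn (show (0 : ℝ) < n by exact_mod_cast hpos)
    rwa [← ENNReal.rpow_mul, one_div_mul_cancel (by positivity), ENNReal.rpow_one] at this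
  rw [ENNReal.rpow_natCast] at hn'
  exact_mod_cast hn'.le

theorem specRadLtOne_of_eigenvalues {M : Matrix k k ℂ}
    (h : ∀ (z : ℂ) (v : k → ℂ), v ≠ 0 → M *ᵥ v = z • v → ‖z‖ < 1) : SpecRadLtOne M := by
  let _ : NormedRing (Matrix k k ℂ) := Matrix.linftyOpNormedRing
  let _ : NormedAlgebra ℂ (Matrix k k ℂ) := Matrix.linftyOpNormedAlgebra
  have : CompleteSpace (Matrix k k ℂ) := FiniteDimensional.complete ℂ _
  rcases subsingleton_or_nontrivial (Matrix k k ℂ) with hs | hs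
  · simp [SpecRadLtOne, Subsingleton.elim M 0]
  · have := spectrum.spectralRadius_lt_of_forall_lt M (r := 1) fun z hz => ?_
    · simpa [SpecRadLtOne] using this
    · rw [← Matrix.spectrum_toLin', ← Module.End.hasEigenvalue_iff_mem_spectrum] at hz
      obtain ⟨v, hv⟩ := hz.exists_hasEigenvector
      have := h z v hv.2 (by simpa using hv.apply_eq_smul)
      exact_mod_cast this

theorem SpecRadLtOne.norm_lt_one {M : Matrix k k ℂ} (h : SpecRadLtOne M) {z : ℂ} {v : k → ℂ}
    (hv : v ≠ 0) (hz : M *ᵥ v = z • v) : ‖z‖ < 1 := by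
  have hmem : z ∈ spectrum ℂ M := by
    rw [← Matrix.spectrum_toLin', ← Module.End.hasEigenvalue_iff_mem_spectrum]
    exact Module.End.hasEigenvalue_of_hasEigenvector
      (Module.End.hasEigenvector_iff.2 ⟨Module.End.mem_eigenspace_iff.2 (by simpa using hz), hv⟩)
  have : (‖z‖₊ : ENNReal) < 1 :=
    lt_of_le_of_lt (le_iSup₂ (f := fun (z : ℂ) (_ : z ∈ spectrum ℂ M) => (‖z‖₊ : ENNReal)) z hmem) h
  exact_mod_cast this

/-- Translates between ρ(σ(T) T) < 1 at σ = id and the usual condition ρ(T) < 1. -/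
theorem specRadLtOne_mul_self_iff {M : Matrix k k ℂ} :
    SpecRadLtOne (M * M) ↔ SpecRadLtOne M := by
  constructor
  · intro h
    refine specRadLtOne_of_eigenvalues fun z v hv hz => ?_
    have := h.norm_lt_one hv (z := z * z) (by
      rw [← mulVec_mulVec, hz, mulVec_smul, hz, smul_smul])
    rw [norm_mul] at this
    nlinarith [norm_nonneg z]
  · intro h
    refine lt_of_le_of_lt ?_ (pow_lt_one₀ zero_le h two_ne_zero)
    let _ : NormedRing (Matrix k k ℂ) := Matrix.linftyOpNormedRing
    let _ : NormedAlgebra ℂ (Matrix k k ℂ) := Matrix.linftyOpNormedAlgebra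
    rcases subsingleton_or_nontrivial (Matrix k k ℂ) with hs | hs
    · simp [Subsingleton.elim M 0]
    · have : CompleteSpace (Matrix k k ℂ) := FiniteDimensional.complete ℂ _
      rw [← sq]
      refine iSup₂_le fun z hz => ?_
      rw [spectrum.map_pow] at hz
      obtain ⟨w, hw, rfl⟩ := hz
      simp only [nnnorm_pow, ENNReal.coe_pow]
      gcongr
      exact le_iSup₂ (f := fun (z : ℂ) (_ : z ∈ spectrum ℂ M) => (‖z‖₊ : ENNReal)) w hw

end Spectral

/-! ### Field automorphisms acting entrywise -/

/-- The two continuous automorphisms of `ℂ`: the identity and complex conjugation. -/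
def IsTwist (σ : ℂ →+* ℂ) : Prop := σ = RingHom.id ℂ ∨ σ = starRingEnd ℂ

theorem isTwist_id : IsTwist (RingHom.id ℂ) := Or.inl rfl

theorem isTwist_star : IsTwist (starRingEnd ℂ) := Or.inr rfl

namespace IsTwist

variable {σ : ℂ →+* ℂ} {k l : Type*}

theorem map_map (hσ : IsTwist σ) (M : Matrix k l ℂ) : (M.map σ).map σ = M := by
  rcases hσ with rfl | rfl <;> ext <;> simp

theorem conjTranspose_map (hσ : IsTwist σ) (M : Matrix k l ℂ) : (M.map σ)ᴴ = Mᴴ.map σ := by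
  rcases hσ with rfl | rfl <;> ext <;> simp

theorem map_real_smul (hσ : IsTwist σ) (r : ℝ) (M : Matrix k l ℂ) :
    (r • M).map σ = r • M.map σ := by
  rcases hσ with rfl | rfl <;> ext <;> simp

theorem isHermitian_map (hσ : IsTwist σ) {M : Matrix k k ℂ} (hM : M.IsHermitian) :
    (M.map σ).IsHermitian := by
  rw [Matrix.IsHermitian, hσ.conjTranspose_map, hM.eq]

theorem posSemidef_map (hσ : IsTwist σ) [Fintype k] {M : Matrix k k ℂ} (hM : M.PosSemidef) :
    (M.map σ).PosSemidef := by
  rcases hσ with rfl | rfl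
  · simpa using hM
  · have : M.map (starRingEnd ℂ) = Mᵀ := by
      conv_rhs => rw [← hM.1.eq]
      rfl
    rw [this]; exact hM.transpose

theorem posDef_map (hσ : IsTwist σ) [Fintype k] {M : Matrix k k ℂ} (hM : M.PosDef) :
    (M.map σ).PosDef := by
  rcases hσ with rfl | rfl
  · simpa using hM
  · have : M.map (starRingEnd ℂ) = Mᵀ := by
      conv_rhs => rw [← hM.1.eq]
      rfl
    rw [this]; exact hM.transpose

end IsTwist

/-! ### Real quadratic forms and the cone of positive semidefinite matrices -/

section QuadForm

variable {k l : Type*} [Fintype k] [Fintype l]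

/-- The real part of the quadratic form `vᴴ M v`. -/
def quadForm (M : Matrix k k ℂ) (v : k → ℂ) : ℝ := (star v ⬝ᵥ (M *ᵥ v)).re

theorem quadForm_sub (M N : Matrix k k ℂ) (v : k → ℂ) :
    quadForm (M - N) v = quadForm M v - quadForm N v := by
  simp [quadForm, sub_mulVec]

theorem quadForm_conj (M : Matrix k k ℂ) (N : Matrix k l ℂ) (v : l → ℂ) :
    quadForm (Nᴴ * M * N) v = quadForm M (N *ᵥ v) := by
  simp only [quadForm, star_mulVec, ← mulVec_mulVec, dotProduct_mulVec, vecMul_vecMul]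

theorem quadForm_smul (M : Matrix k k ℂ) (z : ℂ) (v : k → ℂ) :
    quadForm M (z • v) = ‖z‖ ^ 2 * quadForm M v := by
  have : star z * z = ((‖z‖ ^ 2 : ℝ) : ℂ) := by
    have := Complex.conj_mul' z
    push_cast; exact this
  simp only [quadForm, mulVec_smul, star_smul, dotProduct_smul, smul_dotProduct, smul_eq_mul]
  rw [← mul_assoc, mul_comm z, this, Complex.re_ofReal_mul]

theorem quadForm_nonneg {M : Matrix k k ℂ} (hM : M.PosSemidef) (v : k → ℂ) :
    0 ≤ quadForm M v := hM.re_dotProduct_nonneg v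

theorem quadForm_pos {M : Matrix k k ℂ} (hM : M.PosDef) {v : k → ℂ} (hv : v ≠ 0) :
    0 < quadForm M v := hM.re_dotProduct_pos hv

theorem posDef_of_quadForm_pos {M : Matrix k k ℂ} (hM : M.IsHermitian)
    (h : ∀ v, v ≠ 0 → 0 < quadForm M v) : M.PosDef := by
  refine PosDef.of_dotProduct_mulVec_pos hM fun v hv => ?_
  refine Complex.pos_iff.2 ⟨h v hv, ?_⟩
  have := hM.im_star_dotProduct_mulVec_self v
  simpa using this.symm

theorem isClosed_posSemidef : IsClosed {M : Matrix k k ℂ | M.PosSemidef} := by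
  have : {M : Matrix k k ℂ | M.PosSemidef} =
      {M | Mᴴ = M} ∩ ⋂ v : k → ℂ, {M | 0 ≤ quadForm M v} := by
    ext M
    simp only [Set.mem_ofPred_eq, Set.mem_inter_iff, Set.mem_iInter]
    refine ⟨fun h => ⟨h.1, quadForm_nonneg h⟩, fun h => ?_⟩
    refine PosSemidef.of_dotProduct_mulVec_nonneg h.1 fun v => ?_
    refine Complex.nonneg_iff.2 ⟨h.2 v, ?_⟩
    have := IsHermitian.im_star_dotProduct_mulVec_self h.1 v
    simpa using this.symm
  rw [this]
  refine (isClosed_eq continuous_id.matrix_conjTranspose continuous_id).inter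
    (isClosed_iInter fun v => isClosed_le continuous_const ?_)
  exact Complex.continuous_re.comp
    (continuous_const.dotProduct (continuous_id.matrix_mulVec continuous_const))

open scoped MatrixOrder Matrix.Norms.L2Operator in
theorem exists_eq_conjTranspose_mul_self {M : Matrix k k ℂ} (hM : M.PosSemidef) :
    ∃ C : Matrix k k ℂ, M = Cᴴ * C := by
  classical
  exact CStarAlgebra.nonneg_iff_eq_star_mul_self.1 hM.nonneg

/-- The set is the image under C ↦ Cᴴ C of a closed Frobenius ball, because tr(Cᴴ C) is the sum of
the squared moduli of the entries. -/
theorem isCompact_posSemidef_trace_le (t : ℝ) :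
    IsCompact {M : Matrix k k ℂ | M.PosSemidef ∧ M.trace.re ≤ t} := by
  classical
  have hbound : IsCompact {C : Matrix k k ℂ | (Cᴴ * C).trace.re ≤ t} := by
    have hcont : Continuous fun C : Matrix k k ℂ => (Cᴴ * C).trace.re :=
      Complex.continuous_re.comp
        (continuous_id.matrix_conjTranspose.matrix_mul continuous_id).matrix_trace
    let _ : NormedAddCommGroup (Matrix k k ℂ) := Matrix.normedAddCommGroup
    let _ : NormedSpace ℂ (Matrix k k ℂ) := Matrix.normedSpace
    have : ProperSpace (Matrix k k ℂ) := FiniteDimensional.proper ℂ _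
    refine Metric.isCompact_of_isClosed_isBounded (isClosed_le hcont continuous_const) ?_
    refine (Metric.isBounded_closedBall (x := (0 : Matrix k k ℂ)) (r := √t)).subset fun C hC => ?_
    rw [mem_closedBall_zero_iff, Matrix.norm_le_iff (Real.sqrt_nonneg t)]
    intro i j
    refine Real.le_sqrt_of_sq_le (le_trans ?_ hC)
    have hsum : (Cᴴ * C).trace.re = ∑ b, ∑ a, ‖C a b‖ ^ 2 := by
      simp only [Matrix.trace, Matrix.diag, Matrix.mul_apply, Matrix.conjTranspose_apply,
        Complex.re_sum]
      refine Finset.sum_congr rfl fun b _ => Finset.sum_congr rfl fun a _ => ?_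
      have := Complex.conj_mul' (C a b)
      rw [Complex.star_def, this, ← Complex.ofReal_pow, Complex.ofReal_re]
    change _ ≤ (Cᴴ * C).trace.re
    rw [hsum]
    calc ‖C i j‖ ^ 2 ≤ ∑ a, ‖C a j‖ ^ 2 :=
          Finset.single_le_sum (f := fun a => ‖C a j‖ ^ 2) (fun _ _ => sq_nonneg _)
            (Finset.mem_univ i)
      _ ≤ _ := Finset.single_le_sum (f := fun b => ∑ a, ‖C a b‖ ^ 2)
          (fun _ _ => Finset.sum_nonneg fun _ _ => sq_nonneg _) (Finset.mem_univ j)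
  have himage : {M : Matrix k k ℂ | M.PosSemidef ∧ M.trace.re ≤ t} =
      (fun C : Matrix k k ℂ => Cᴴ * C) '' {C | (Cᴴ * C).trace.re ≤ t} := by
    ext M
    constructor
    · rintro ⟨hM, ht⟩
      obtain ⟨C, rfl⟩ := exists_eq_conjTranspose_mul_self hM
      exact ⟨C, ht, rfl⟩
    · rintro ⟨C, hC, rfl⟩
      exact ⟨posSemidef_conjTranspose_mul_self C, hC⟩
  rw [himage]
  exact hbound.image (continuous_id.matrix_conjTranspose.matrix_mul continuous_id)

theorem trace_re_nonneg {M : Matrix k k ℂ} (hM : M.PosSemidef) : 0 ≤ M.trace.re :=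
  (Complex.nonneg_iff.1 hM.trace_nonneg).1

theorem eq_zero_of_trace_re_nonpos {M : Matrix k k ℂ} (hM : M.PosSemidef)
    (h : M.trace.re ≤ 0) : M = 0 := by
  refine hM.trace_eq_zero_iff.1 (Complex.ext ?_ ?_)
  · exact le_antisymm h (trace_re_nonneg hM)
  · exact (Complex.nonneg_iff.1 hM.trace_nonneg).2.symm

end QuadForm

/-! ### Twisted Stein equations -/

section Stein

variable {k : Type*} [Fintype k] {σ : ℂ →+* ℂ}

theorem conj_stein_twice (hσ : IsTwist σ) (T D : Matrix k k ℂ) :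
    Tᴴ * (Tᴴ * D.map σ * T).map σ * T = (T.map σ * T)ᴴ * D * (T.map σ * T) := by
  rw [Matrix.map_mul, Matrix.map_mul, hσ.map_map, conjTranspose_mul, hσ.conjTranspose_map]
  simp only [Matrix.mul_assoc]

variable [DecidableEq k]

theorem tendsto_stein {M : Matrix k k ℂ} (hM : SpecRadLtOne M) (D : Matrix k k ℂ) :
    Tendsto (fun n : ℕ => (M ^ n)ᴴ * D * M ^ n) atTop (𝓝 0) := by
  have hc : Continuous fun N : Matrix k k ℂ => Nᴴ * D * N :=
    (continuous_id.matrix_conjTranspose.matrix_mul continuous_const).matrix_mul continuous_id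
  simpa [Function.comp_def] using (hc.tendsto 0).comp hM.tendsto_pow

/-- Telescoping gives D ≥ (Mⁿ)ᴴ D Mⁿ for every n, and the right side tends to 0. -/
theorem posSemidef_of_stein {M D : Matrix k k ℂ} (hM : SpecRadLtOne M)
    (h : (D - Mᴴ * D * M).PosSemidef) : D.PosSemidef := by
  have hn : ∀ n : ℕ, (D - (M ^ n)ᴴ * D * M ^ n).PosSemidef := by
    intro n
    induction n with
    | zero => simpa using PosSemidef.zero
    | succ n ih =>
      have : D - (M ^ (n + 1))ᴴ * D * M ^ (n + 1) =
          (D - (M ^ n)ᴴ * D * M ^ n) + (M ^ n)ᴴ * (D - Mᴴ * D * M) * M ^ n := by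
        rw [pow_succ', conjTranspose_mul]
        noncomm_ring
      rw [this]
      exact ih.add (h.conjTranspose_mul_mul_same _)
  have hlim : Tendsto (fun n : ℕ => D - (M ^ n)ᴴ * D * M ^ n) atTop (𝓝 D) := by
    simpa using (tendsto_stein hM D).const_sub D
  exact isClosed_posSemidef.mem_of_tendsto hlim (Eventually.of_forall hn)

/-- With S the twisted Stein operator, D - S²D = (D - SD) + S(D - SD). Since S preserves positivity,
the untwisted case applies to S². -/
theorem posSemidef_of_twisted_stein (hσ : IsTwist σ) {T D : Matrix k k ℂ}
    (hT : SpecRadLtOne (T.map σ * T))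
    (h : (D - Tᴴ * D.map σ * T).PosSemidef) : D.PosSemidef := by
  refine posSemidef_of_stein hT ?_
  have : D - (T.map σ * T)ᴴ * D * (T.map σ * T) =
      (D - Tᴴ * D.map σ * T) + Tᴴ * (D - Tᴴ * D.map σ * T).map σ * T := by
    rw [← conj_stein_twice hσ, Matrix.map_sub _ (map_sub σ)]
    noncomm_ring
  rw [this]
  exact h.add ((hσ.posSemidef_map h).conjTranspose_mul_mul_same T)

theorem eq_zero_of_twisted_stein (hσ : IsTwist σ) {T D : Matrix k k ℂ}
    (hT : SpecRadLtOne (T.map σ * T))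
    (h : D = Tᴴ * D.map σ * T) : D = 0 := by
  have h2 : D = (T.map σ * T)ᴴ * D * (T.map σ * T) := by
    rw [← conj_stein_twice hσ, ← h, ← h]
  have hn : ∀ n : ℕ, ((T.map σ * T) ^ n)ᴴ * D * (T.map σ * T) ^ n = D := by
    intro n
    induction n with
    | zero => simp
    | succ n ih =>
      rw [pow_succ', conjTranspose_mul]
      conv_rhs => rw [← ih, h2]
      noncomm_ring
  have := tendsto_stein hT D
  simp only [hn] at this
  exact tendsto_nhds_unique tendsto_const_nhds this

theorem exists_twisted_stein (hσ : IsTwist σ) {T Q : Matrix k k ℂ}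
    (hT : SpecRadLtOne (T.map σ * T))
    (hQ : Q.IsHermitian) : ∃ X : Matrix k k ℂ, X.IsHermitian ∧ X = Tᴴ * X.map σ * T + Q := by
  -- Only real-linear, since σ may be conjugation; injectivity still gives surjectivity in finite
  -- dimension.
  let Φ : Matrix k k ℂ →ₗ[ℝ] Matrix k k ℂ :=
    { toFun := fun X => X - Tᴴ * X.map σ * T
      map_add' := fun X Y => by
        rw [Matrix.map_add _ (map_add σ)]; noncomm_ring
      map_smul' := fun r X => by
        rw [hσ.map_real_smul]
        simp [smul_sub] }
  have hinj : Function.Injective Φ := by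
    rw [injective_iff_map_eq_zero]
    intro D hD
    exact eq_zero_of_twisted_stein hσ hT (sub_eq_zero.1 hD)
  obtain ⟨X, hX⟩ := LinearMap.injective_iff_surjective.1 hinj Q
  have hX' : X - Tᴴ * X.map σ * T = Q := hX
  refine ⟨X, ?_, by rw [← hX']; abel⟩
  -- Xᴴ solves the same equation because Q is Hermitian, so uniqueness gives Xᴴ = X.
  refine hinj ?_
  rw [hX, ← hQ.eq, ← hX']
  change Xᴴ - Tᴴ * Xᴴ.map σ * T = _
  simp only [conjTranspose_sub, conjTranspose_mul, conjTranspose_conjTranspose,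
    hσ.conjTranspose_map, Matrix.mul_assoc]

end Stein

/-! ### The algebra of the Riccati map -/

section Riccati

variable {k l : Type*} [Fintype k]

/-- `R + Bᴴ Y B`. -/
def weight (B : Matrix k l ℂ) (R : Matrix l l ℂ) (Y : Matrix k k ℂ) : Matrix l l ℂ :=
  R + Bᴴ * Y * B

variable {A : Matrix k k ℂ} {B : Matrix k l ℂ} {R : Matrix l l ℂ} {H : Matrix k k ℂ}

theorem weight_add (Y D : Matrix k k ℂ) : weight B R (Y + D) = weight B R Y + Bᴴ * D * B := by
  simp only [weight, Matrix.mul_add, Matrix.add_mul, add_assoc]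

theorem isHermitian_weight (hR : R.IsHermitian) {Y : Matrix k k ℂ} (hY : Y.IsHermitian) :
    (weight B R Y).IsHermitian :=
  hR.add (isHermitian_conjTranspose_mul_mul B hY)

variable [Fintype l]

theorem posDef_weight_of_le {Y Z : Matrix k k ℂ} (h : (Z - Y).PosSemidef)
    (hY : (weight B R Y).PosDef) : (weight B R Z).PosDef := by
  have : weight B R Z = weight B R Y + Bᴴ * (Z - Y) * B := by
    rw [← weight_add, add_sub_cancel]
  rw [this]
  exact hY.add_posSemidef (h.conjTranspose_mul_mul_same B)

variable [DecidableEq l]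

/-- The feedback gain `(R + Bᴴ Y B)⁻¹ Bᴴ Y A`. -/
def gain (A : Matrix k k ℂ) (B : Matrix k l ℂ) (R : Matrix l l ℂ) (Y : Matrix k k ℂ) :
    Matrix l k ℂ :=
  (weight B R Y)⁻¹ * Bᴴ * Y * A

/-- The Riccati map `Aᴴ Y A - Aᴴ Y B (R + Bᴴ Y B)⁻¹ Bᴴ Y A + H`. -/
def riccatiMap (A : Matrix k k ℂ) (B : Matrix k l ℂ) (R : Matrix l l ℂ) (H Y : Matrix k k ℂ) :
    Matrix k k ℂ :=
  Aᴴ * Y * A - Aᴴ * Y * B * (weight B R Y)⁻¹ * Bᴴ * Y * A + H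

/-- Completing the square in the control variable. -/
theorem riccati_completion {j : Type*} [Fintype j] (hR : R.IsHermitian) {Y : Matrix k k ℂ}
    (hY : Y.IsHermitian)
    (hW : IsUnit (weight B R Y).det) (Z : Matrix k j ℂ) (P : Matrix l j ℂ) :
    (A * Z - B * P)ᴴ * Y * (A * Z - B * P) + Pᴴ * R * P + Zᴴ * H * Z =
      Zᴴ * riccatiMap A B R H Y * Z +
        (P - gain A B R Y * Z)ᴴ * weight B R Y * (P - gain A B R Y * Z) := by
  have hWK : weight B R Y * gain A B R Y = Bᴴ * Y * A := by
    simp only [gain, ← Matrix.mul_assoc]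
    rw [Matrix.mul_nonsing_inv _ hW, Matrix.one_mul]
  have hKW : (gain A B R Y)ᴴ * weight B R Y = Aᴴ * Y * B := by
    have := congrArg conjTranspose hWK
    simpa only [conjTranspose_mul, (isHermitian_weight (B := B) hR hY).eq, hY.eq,
      conjTranspose_conjTranspose, Matrix.mul_assoc] using this
  have hric : riccatiMap A B R H Y = Aᴴ * Y * A - Aᴴ * Y * B * gain A B R Y + H := by
    simp only [riccatiMap, gain, Matrix.mul_assoc]
  have hsq : (P - gain A B R Y * Z)ᴴ * weight B R Y * (P - gain A B R Y * Z) =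
      Pᴴ * weight B R Y * P - Pᴴ * (Bᴴ * Y * A) * Z - Zᴴ * (Aᴴ * Y * B) * P +
        Zᴴ * (Aᴴ * Y * B) * gain A B R Y * Z := by
    rw [← hKW, ← hWK]
    simp only [conjTranspose_sub, conjTranspose_mul, Matrix.mul_sub, Matrix.sub_mul,
      Matrix.mul_assoc]
    abel
  rw [hsq, hric, weight]
  simp only [conjTranspose_sub, conjTranspose_mul, Matrix.mul_sub, Matrix.sub_mul,
    Matrix.mul_add, Matrix.add_mul, Matrix.mul_assoc]
  abel

theorem continuousOn_riccatiMap :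
    ContinuousOn (riccatiMap A B R H) {Y | (weight B R Y).det ≠ 0} := by
  have hinv : ContinuousOn (fun Y : Matrix k k ℂ => (weight B R Y)⁻¹)
      {Y | (weight B R Y).det ≠ 0} := by
    have hw : Continuous fun Y : Matrix k k ℂ => weight B R Y :=
      continuous_const.add ((continuous_const.matrix_mul continuous_id).matrix_mul continuous_const)
    simp only [Matrix.inv_def, Ring.inverse_eq_inv']
    exact (hw.matrix_det.continuousOn.inv₀ fun Y hY => hY).smul hw.matrix_adjugate.continuousOn
  have hφ : Continuous fun p : Matrix k k ℂ × Matrix l l ℂ =>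
      Aᴴ * p.1 * A - Aᴴ * p.1 * B * p.2 * Bᴴ * p.1 * A + H := by
    fun_prop
  refine (hφ.comp_continuousOn (continuousOn_id.prodMk hinv)).congr fun Y _ => ?_
  simp only [riccatiMap, Function.comp_apply, id_eq]

variable [DecidableEq k]

/-- The value of a feedback exceeds the Riccati map by a square. -/
theorem riccati_feedback (hR : R.IsHermitian) {Y : Matrix k k ℂ} (hY : Y.IsHermitian)
    (hW : IsUnit (weight B R Y).det) (F : Matrix l k ℂ) :
    (A - B * F)ᴴ * Y * (A - B * F) + Fᴴ * R * F + H =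
      riccatiMap A B R H Y +
        (F - gain A B R Y)ᴴ * weight B R Y * (F - gain A B R Y) := by
  simpa using riccati_completion (A := A) (H := H) hR hY hW 1 F

theorem riccati_gain (hR : R.IsHermitian) {Y : Matrix k k ℂ} (hY : Y.IsHermitian)
    (hW : IsUnit (weight B R Y).det) :
    (A - B * gain A B R Y)ᴴ * Y * (A - B * gain A B R Y) +
      (gain A B R Y)ᴴ * R * gain A B R Y + H = riccatiMap A B R H Y := by
  simpa using riccati_feedback (A := A) (H := H) hR hY hW (gain A B R Y)

theorem isUnit_det_of_posDef {W : Matrix l l ℂ} (hW : W.PosDef) : IsUnit W.det :=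
  isUnit_iff_ne_zero.2 hW.det_pos.ne'

theorem isHermitian_riccatiMap (hR : R.IsHermitian) (hH : H.IsHermitian) {Y : Matrix k k ℂ}
    (hY : Y.IsHermitian) (hW : IsUnit (weight B R Y).det) :
    (riccatiMap A B R H Y).IsHermitian := by
  rw [← riccati_gain hR hY hW]
  exact ((isHermitian_conjTranspose_mul_mul _ hY).add (isHermitian_conjTranspose_mul_mul _ hR)).add hH

/-- Any feedback dominates the Riccati map. -/
theorem riccatiMap_le_feedback (hR : R.IsHermitian) {Y : Matrix k k ℂ} (hY : Y.IsHermitian)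
    (hW : (weight B R Y).PosDef) (F : Matrix l k ℂ) :
    ((A - B * F)ᴴ * Y * (A - B * F) + Fᴴ * R * F + H - riccatiMap A B R H Y).PosSemidef := by
  rw [riccati_feedback hR hY (isUnit_det_of_posDef hW), add_sub_cancel_left]
  exact hW.posSemidef.conjTranspose_mul_mul_same _

/-- The gain K optimal at Z attains the value at Z; its cost at Y is no larger than its cost at Z,
yet still dominates the Riccati map at Y. -/
theorem riccatiMap_mono (hR : R.IsHermitian) {Y Z : Matrix k k ℂ} (hY : Y.IsHermitian)
    (hZ : Z.IsHermitian) (h : (Z - Y).PosSemidef) (hW : (weight B R Y).PosDef) :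
    (riccatiMap A B R H Z - riccatiMap A B R H Y).PosSemidef := by
  have hWZ := isUnit_det_of_posDef (posDef_weight_of_le h hW)
  have h1 := riccatiMap_le_feedback (A := A) (H := H) hR hY hW (gain A B R Z)
  have h2 := h.conjTranspose_mul_mul_same (A - B * gain A B R Z)
  rw [← riccati_gain (A := A) (H := H) hR hZ hWZ]
  convert h1.add h2 using 1
  simp only [Matrix.mul_sub, Matrix.sub_mul]
  abel

/-! ### Policy improvement -/

/-- One improvement step suffices because only a supersolution is wanted, not a solution. The
subsolution X₀ supplies a form D = X - X₀ ≥ 0 that acts as a Lyapunov function for the improved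
closed loop. -/
theorem exists_stabilizing {σ : ℂ →+* ℂ} (hσ : IsTwist σ) (hR : R.IsHermitian)
    (hH : H.IsHermitian) {X₀ : Matrix k k ℂ} (hX₀ : X₀.IsHermitian)
    (hW₀ : (weight B R (X₀.map σ)).PosDef)
    (hle : (riccatiMap A B R H (X₀.map σ) - X₀).PosSemidef) {F : Matrix l k ℂ}
    (hF : SpecRadLtOne ((A - B * F).map σ * (A - B * F))) :
    ∃ X : Matrix k k ℂ, X.IsHermitian ∧ (X - X₀).PosSemidef ∧
      (X - riccatiMap A B R H (X.map σ)).PosSemidef ∧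
      SpecRadLtOne ((A - B * gain A B R (X.map σ)).map σ * (A - B * gain A B R (X.map σ))) := by
  obtain ⟨X, hX, hXeq⟩ := exists_twisted_stein hσ hF (Q := Fᴴ * R * F + H)
    ((isHermitian_conjTranspose_mul_mul F hR).add hH)
  have hD : (X - X₀).PosSemidef := by
    refine posSemidef_of_twisted_stein hσ hF ?_
    convert (riccatiMap_le_feedback (A := A) (H := H) hR (hσ.isHermitian_map hX₀) hW₀ F).add hle
      using 1
    conv_lhs => lhs; lhs; rw [hXeq]
    rw [Matrix.map_sub _ (map_sub σ)]
    simp only [Matrix.mul_sub, Matrix.sub_mul]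
    abel
  have hDσ : (X.map σ - X₀.map σ).PosSemidef := by
    rw [← Matrix.map_sub _ (map_sub σ)]; exact hσ.posSemidef_map hD
  have hW := posDef_weight_of_le hDσ hW₀
  have hWu := isUnit_det_of_posDef hW
  have hXσ := hσ.isHermitian_map hX
  set K := gain A B R (X.map σ) with hK
  set W := weight B R (X.map σ) with hWdef
  have hgap : X = riccatiMap A B R H (X.map σ) + (F - K)ᴴ * W * (F - K) := by
    rw [hK, hWdef, ← riccati_feedback hR hXσ hWu F, add_assoc]
    exact hXeq
  refine ⟨X, hX, hD, ?_, ?_⟩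
  · have : X - riccatiMap A B R H (X.map σ) = (F - K)ᴴ * W * (F - K) :=
      sub_eq_iff_eq_add'.2 hgap
    rw [this]
    exact hW.posSemidef.conjTranspose_mul_mul_same _
  set T := A - B * K with hT
  set D := X - X₀ with hDdef
  -- The left side equals the cost of the feedback K at X₀ minus X₀, which is nonnegative as X₀ is a
  -- subsolution.
  have hDsub : (D - Tᴴ * D.map σ * T - (F - K)ᴴ * W * (F - K)).PosSemidef := by
    convert (riccatiMap_le_feedback (A := A) (H := H) hR (hσ.isHermitian_map hX₀) hW₀ K).add hle
      using 1
    rw [hDdef, Matrix.map_sub _ (map_sub σ)]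
    conv_lhs => lhs; lhs; lhs; rw [hgap, ← riccati_gain hR hXσ hWu]
    simp only [Matrix.mul_sub, Matrix.sub_mul, ← hK, ← hT]
    abel
  -- The decrease of D is used twice, at v and, after applying σ, at T v.
  have hquad : ∀ v, quadForm W ((F - K) *ᵥ v) + quadForm D ((T.map σ * T) *ᵥ v) +
      quadForm (W.map σ) ((F - K).map σ *ᵥ (T *ᵥ v)) ≤ quadForm D v := by
    intro v
    have h1 := quadForm_nonneg hDsub v
    have h2 := quadForm_nonneg (hσ.posSemidef_map hDsub) (T *ᵥ v)
    have h3 := congrArg (fun M => quadForm M v) (conj_stein_twice hσ T D)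
    simp only [quadForm_sub, quadForm_conj] at h1 h3
    rw [Matrix.map_sub _ (map_sub σ), Matrix.map_sub _ (map_sub σ), quadForm_sub, quadForm_sub,
      h3, Matrix.map_mul, Matrix.map_mul, ← hσ.conjTranspose_map, quadForm_conj] at h2
    linarith
  -- If |z| ≥ 1, the decrease must vanish, so F and K agree on v, and σ(F) and σ(K) on T v. Then v
  -- is an eigenvector for the same z of the loop closed by F, which is stable.
  refine specRadLtOne_of_eigenvalues fun z v hv hz => ?_
  by_contra hz1
  have hz1 : 1 ≤ ‖z‖ ^ 2 := one_le_pow₀ (not_lt.1 hz1)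
  have hq := hquad v
  rw [hz, quadForm_smul] at hq
  have hDv := quadForm_nonneg hD v
  have ha := quadForm_nonneg hW.posSemidef ((F - K) *ᵥ v)
  have hb := quadForm_nonneg (hσ.posSemidef_map hW.posSemidef) ((F - K).map σ *ᵥ (T *ᵥ v))
  have hzD : quadForm D v ≤ ‖z‖ ^ 2 * quadForm D v := le_mul_of_one_le_left hDv hz1
  have hFv : (F - K) *ᵥ v = 0 := by
    by_contra hne
    linarith [quadForm_pos hW hne]
  have hFTv : (F - K).map σ *ᵥ (T *ᵥ v) = 0 := by
    by_contra hne
    linarith [quadForm_pos (hσ.posDef_map hW) hne]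
  have hAF : A - B * F = T - B * (F - K) := by
    rw [hT, Matrix.mul_sub]; abel
  have h1 : (A - B * F) *ᵥ v = T *ᵥ v := by
    rw [hAF, sub_mulVec, ← mulVec_mulVec, hFv, mulVec_zero, sub_zero]
  have h2 : (A - B * F).map σ *ᵥ (T *ᵥ v) = T.map σ *ᵥ (T *ᵥ v) := by
    rw [hAF, Matrix.map_sub _ (map_sub σ), Matrix.map_mul, sub_mulVec, ← mulVec_mulVec, hFTv,
      mulVec_zero, sub_zero]
  have hlt := hF.norm_lt_one hv (z := z) (by
    rw [← mulVec_mulVec, h1, h2, mulVec_mulVec, hz])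
  have : ‖z‖ ^ 2 < 1 := by nlinarith [norm_nonneg z]
  linarith

/-! ### Solutions between a subsolution and a supersolution -/

/-- A Knaster–Tarski argument, with compactness and the trace replacing lattice completeness: among
supersolutions above X₀ of bounded trace, one of least trace is fixed. The map is conjugated by the
shift X₀ + D so as to act on the positive semidefinite cone. -/
theorem exists_riccati_fixedPoint (hR : R.IsHermitian) {X₀ X₁ : Matrix k k ℂ}
    (hX₀ : X₀.IsHermitian) (hW₀ : (weight B R X₀).PosDef)
    (hle₀ : (riccatiMap A B R H X₀ - X₀).PosSemidef) (h01 : (X₁ - X₀).PosSemidef)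
    (hle₁ : (X₁ - riccatiMap A B R H X₁).PosSemidef) :
    ∃ X : Matrix k k ℂ, X.IsHermitian ∧ (X - X₀).PosSemidef ∧ X = riccatiMap A B R H X := by
  let f : Matrix k k ℂ → Matrix k k ℂ := fun D => riccatiMap A B R H (X₀ + D) - X₀
  have hherm : ∀ {D : Matrix k k ℂ}, D.PosSemidef → (X₀ + D).IsHermitian := fun hD => hX₀.add hD.1
  have hmono : ∀ {D E : Matrix k k ℂ}, D.PosSemidef → E.PosSemidef → (E - D).PosSemidef →
      (f E - f D).PosSemidef := by
    intro D E hD hE h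
    have := riccatiMap_mono (A := A) (H := H) (B := B) hR (hherm hD) (hherm hE)
      (by simpa using h) (posDef_weight_of_le (by simpa using hD) hW₀)
    simpa [f] using this
  have hf0 : (f 0).PosSemidef := by simpa [f] using hle₀
  have hfnn : ∀ {D : Matrix k k ℂ}, D.PosSemidef → (f D).PosSemidef := by
    intro D hD
    have := (hmono PosSemidef.zero hD (by simpa using hD)).add hf0
    simpa using this
  have hcont : ContinuousOn f {D | D.PosSemidef} := by
    refine ContinuousOn.sub (continuousOn_riccatiMap.comp (t := {Y | (weight B R Y).det ≠ 0})
      (continuous_const.add continuous_id).continuousOn fun D hD => ?_) continuousOn_const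
    exact (posDef_weight_of_le (Y := X₀) (Z := X₀ + D) (by simpa using hD) hW₀).det_pos.ne'
  let S : Set (Matrix k k ℂ) :=
    {D | D.PosSemidef ∧ D.trace.re ≤ (X₁ - X₀).trace.re} ∩ (fun D => D - f D) ⁻¹' {D | D.PosSemidef}
  have hS : IsCompact S := by
    have hK := isCompact_posSemidef_trace_le (k := k) (X₁ - X₀).trace.re
    refine hK.of_isClosed_subset ?_ Set.inter_subset_left
    exact (continuousOn_id.sub (hcont.mono fun D hD => hD.1)).preimage_isClosed_of_isClosed
      hK.isClosed isClosed_posSemidef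
  have hne : S.Nonempty := by
    refine ⟨X₁ - X₀, ⟨h01, le_rfl⟩, ?_⟩
    change (X₁ - X₀ - f (X₁ - X₀)).PosSemidef
    simpa [f] using hle₁
  obtain ⟨D, ⟨⟨hD, hDt⟩, hDf⟩, hmin⟩ := hS.exists_isMinOn hne
    (f := fun D : Matrix k k ℂ => D.trace.re)
    (Complex.continuous_re.comp continuous_id.matrix_trace).continuousOn
  have hDf : (D - f D).PosSemidef := hDf
  have htr : (f D).trace.re ≤ D.trace.re := by
    have := trace_re_nonneg hDf
    rw [trace_sub, Complex.sub_re] at this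
    linarith
  -- By monotonicity f D is again a supersolution, so minimality forces D - f D ≥ 0 to have trace at
  -- most 0.
  have hfS : f D ∈ S := ⟨⟨hfnn hD, htr.trans hDt⟩, hmono (hfnn hD) hD hDf⟩
  have hzero : D - f D = 0 := by
    refine eq_zero_of_trace_re_nonpos hDf ?_
    have : D.trace.re ≤ (f D).trace.re := hmin hfS
    rw [trace_sub, Complex.sub_re]
    linarith
  refine ⟨X₀ + D, hherm hD, by simpa using hD, ?_⟩
  have : D = riccatiMap A B R H (X₀ + D) - X₀ := sub_eq_zero.1 hzero
  exact (eq_sub_iff_add_eq'.1 this)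

end Riccati

/-! ### The transformed equation -/

namespace Coeffs

variable {n m : ℕ} (c : Coeffs n m)

theorem hatA_eq : c.hatA = conj c.A * c.AF (c.FX c.H) := by
  simp only [hatA, AF, FX, Matrix.mul_sub, Matrix.mul_assoc]

/-- The Woodbury identity for (I + G H̄)⁻¹. It exhibits Ĥ as an optimal one-step cost with terminal
weight H. -/
theorem hatH_eq (hRdet : c.R.det ≠ 0) (hRH : (c.RX c.H).det ≠ 0) : c.hatH = c.ric c.H := by
  have hR := isUnit_iff_ne_zero.2 hRdet
  have hinv : (1 + c.G * conj c.H)⁻¹ = 1 - c.B * (c.RX c.H)⁻¹ * c.Bᴴ * conj c.H := by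
    refine Matrix.inv_eq_right_inv ?_
    have h1 : c.R⁻¹ * (c.Bᴴ * conj c.H * c.B) * (c.RX c.H)⁻¹ = c.R⁻¹ - (c.RX c.H)⁻¹ := by
      have : c.Bᴴ * conj c.H * c.B = c.RX c.H - c.R := by rw [RX, add_sub_cancel_left]
      rw [this, Matrix.mul_sub, Matrix.sub_mul, Matrix.nonsing_inv_mul _ hR, Matrix.one_mul,
        Matrix.mul_assoc, Matrix.mul_nonsing_inv _ (isUnit_iff_ne_zero.2 hRH), Matrix.mul_one]
    have h2 : c.G * conj c.H * (c.B * (c.RX c.H)⁻¹ * c.Bᴴ * conj c.H) =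
        c.B * (c.R⁻¹ * (c.Bᴴ * conj c.H * c.B) * (c.RX c.H)⁻¹) * c.Bᴴ * conj c.H := by
      simp only [G, Matrix.mul_assoc]
    rw [Matrix.mul_sub, Matrix.mul_one, Matrix.add_mul, h2, h1, G]
    simp only [Matrix.mul_sub, Matrix.sub_mul, Matrix.one_mul]
    abel
  rw [hatH, hinv, ric, Matrix.mul_sub, Matrix.sub_mul, Matrix.mul_one, add_comm]
  simp only [Matrix.mul_assoc]

theorem hatB_mul {j : Type*} (F : Matrix (Fin m ⊕ Fin m) j ℂ) :
    c.hatB * F = conj c.B * F.toRows₁ + conj c.A * (c.B * F.toRows₂) := by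
  conv_lhs => rw [← fromRows_toRows F]
  rw [hatB, fromCols_mul_fromRows, Matrix.mul_assoc]

theorem conj_hatR_mul {j : Type*} (F : Matrix (Fin m ⊕ Fin m) j ℂ) :
    Fᴴ * c.hatR * F = F.toRows₁ᴴ * conj c.R * F.toRows₁ + F.toRows₂ᴴ * c.RX c.H * F.toRows₂ := by
  conv_lhs => rw [← fromRows_toRows F]
  rw [hatR, conjTranspose_fromRows_eq_fromCols_conjTranspose, fromCols_mul_fromBlocks,
    fromCols_mul_fromRows]
  simp

variable {c}

theorem isHermitian_conj {X : Matrix (Fin n) (Fin n) ℂ} (hX : X.IsHermitian) :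
    (conj X).IsHermitian := isTwist_star.isHermitian_map hX

theorem isHermitian_RX (hR : c.R.IsHermitian) {X : Matrix (Fin n) (Fin n) ℂ}
    (hX : X.IsHermitian) : (c.RX X).IsHermitian :=
  isHermitian_weight hR (isHermitian_conj hX)

theorem isHermitian_hatR (hR : c.R.IsHermitian) (hH : c.H.IsHermitian) : c.hatR.IsHermitian :=
  (isTwist_star.isHermitian_map hR).fromBlocks (by simp) (isHermitian_RX hR hH)

/-- The second of the two control steps merged in the transformed equation, at a subsolution. -/
theorem second_step_le (hR : c.R.IsHermitian) {X : Matrix (Fin n) (Fin n) ℂ}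
    (hX : X.IsHermitian) (hW : (c.RX X).PosDef) (hle : (c.ric X - X).PosSemidef)
    {j : Type*} [Fintype j] (Z : Matrix (Fin n) j ℂ) (P : Matrix (Fin m) j ℂ) :
    ((conj c.A * Z - conj c.B * P)ᴴ * X * (conj c.A * Z - conj c.B * P) + Pᴴ * conj c.R * P +
      Zᴴ * conj c.H * Z - Zᴴ * conj X * Z -
      (P - conj (c.FX X) * Z)ᴴ * conj (c.RX X) * (P - conj (c.FX X) * Z)).PosSemidef := by
  have h := riccati_completion (A := c.A) (B := c.B) (H := c.H) hR (isHermitian_conj hX)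
    (isUnit_det_of_posDef hW) (conj Z) (conj P)
  have h' := congrArg (fun M => M.map (starRingEnd ℂ)) h
  simp only [conj, Matrix.map_add _ (map_add (starRingEnd ℂ)),
    Matrix.map_sub _ (map_sub (starRingEnd ℂ)), Matrix.map_mul,
    ← isTwist_star.conjTranspose_map, isTwist_star.map_map] at h'
  have hps := (isTwist_star.posSemidef_map hle).conjTranspose_mul_mul_same Z
  rw [Matrix.map_sub _ (map_sub (starRingEnd ℂ)), Matrix.mul_sub, Matrix.sub_mul] at hps
  convert hps using 1
  rw [sub_right_comm]
  exact congrArg (· - Zᴴ * conj X * Z) (sub_eq_iff_eq_add.2 h')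

/-- Reading the merged control as a pair (p, q), the two-step estimate with state Z = B q and
control -p bounds R̂_X below by the form of R_X at q plus that of its conjugate at p + conj(F_X) B
q. This triangular change of variables is invertible. -/
theorem posDef_hatRX (hR : c.R.IsHermitian) (hH : c.H.IsHermitian)
    {X : Matrix (Fin n) (Fin n) ℂ} (hX : X.IsHermitian) (hW : (c.RX X).PosDef)
    (hle : (c.ric X - X).PosSemidef) : (c.hatRX X).PosDef := by
  -- The coordinate projections onto the two control blocks.
  set p : Matrix (Fin m) (Fin m ⊕ Fin m) ℂ := toRows₁ (1 : Matrix (Fin m ⊕ Fin m) (Fin m ⊕ Fin m) ℂ)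
    with hp
  set q : Matrix (Fin m) (Fin m ⊕ Fin m) ℂ := toRows₂ (1 : Matrix (Fin m ⊕ Fin m) (Fin m ⊕ Fin m) ℂ)
    with hq
  have hB : c.hatB = conj c.B * p + conj c.A * (c.B * q) := by
    rw [hp, hq, ← hatB_mul, Matrix.mul_one]
  have hRhat : c.hatR = pᴴ * conj c.R * p + qᴴ * c.RX c.H * q := by
    rw [hp, hq, ← conj_hatR_mul, conjTranspose_one, Matrix.mul_one, Matrix.one_mul]
  have hps := second_step_le hR hX hW hle (c.B * q) (-p)
  have hrepr : c.hatRX X - qᴴ * c.RX X * q -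
      (-p - conj (c.FX X) * (c.B * q))ᴴ * conj (c.RX X) * (-p - conj (c.FX X) * (c.B * q)) =
      ((conj c.A * (c.B * q) - conj c.B * -p)ᴴ * X * (conj c.A * (c.B * q) - conj c.B * -p) +
        (-p)ᴴ * conj c.R * -p + (c.B * q)ᴴ * conj c.H * (c.B * q) -
        (c.B * q)ᴴ * conj X * (c.B * q) -
        (-p - conj (c.FX X) * (c.B * q))ᴴ * conj (c.RX X) *
          (-p - conj (c.FX X) * (c.B * q))) := by
    congr 1
    rw [hatRX, hRhat, hB, RX, RX]
    simp only [conjTranspose_mul, conjTranspose_neg, conjTranspose_add, Matrix.mul_neg,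
      Matrix.neg_mul, sub_neg_eq_add, neg_neg, Matrix.mul_add, Matrix.add_mul, Matrix.mul_assoc]
    abel
  rw [← hrepr] at hps
  refine posDef_of_quadForm_pos
    (isHermitian_weight (isHermitian_hatR hR hH) hX) fun v hv => ?_
  have hnn := quadForm_nonneg hps v
  rw [quadForm_sub, quadForm_sub, quadForm_conj, quadForm_conj] at hnn
  have hWσ : (conj (c.RX X)).PosDef := isTwist_star.posDef_map hW
  have h1 := quadForm_nonneg hW.posSemidef (q *ᵥ v)
  have h2 := quadForm_nonneg hWσ.posSemidef ((-p - conj (c.FX X) * (c.B * q)) *ᵥ v)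
  by_cases hqv : q *ᵥ v = 0
  · have hpv : (-p - conj (c.FX X) * (c.B * q)) *ᵥ v ≠ 0 := by
      intro h0
      rw [sub_mulVec, ← Matrix.mul_assoc, ← mulVec_mulVec, hqv, mulVec_zero, sub_zero, neg_mulVec,
        neg_eq_zero] at h0
      apply hv
      have h3 : fromRows p q *ᵥ v = v := by rw [hp, hq, fromRows_toRows, one_mulVec]
      rw [← h3, fromRows_mulVec, h0, hqv]
      ext (i | i) <;> rfl
    linarith [quadForm_pos hWσ hpv]
  · linarith [quadForm_pos hW hqv]

/-- The optimal merged gain splits into a first feedback F and a second control P. The second step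
costs at least the form of X̄ at the intermediate state, and the first then costs at least ℛ(X) ≥ X.
-/
theorem le_hatRic (hR : c.R.IsHermitian) (hRdet : c.R.det ≠ 0) (hH : c.H.IsHermitian)
    (hRH : (c.RX c.H).det ≠ 0)
    {X : Matrix (Fin n) (Fin n) ℂ} (hX : X.IsHermitian) (hW : (c.RX X).PosDef)
    (hle : (c.ric X - X).PosSemidef) : (c.hatRic X - X).PosSemidef := by
  have hhat := riccati_gain (A := c.hatA) (H := c.hatH) (isHermitian_hatR hR hH) hX
    (isUnit_det_of_posDef (posDef_hatRX hR hH hX hW hle))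
  set K := gain c.hatA c.hatB c.hatR X
  set P := K.toRows₁
  -- contains the loop already closed by F_H, so the second block of K is the deviation of the
  -- actual feedback from F_H.
  set F := K.toRows₂ + c.FX c.H with hF
  have hT : c.hatA - c.hatB * K = conj c.A * c.AF F - conj c.B * P := by
    rw [hatB_mul, hatA_eq]
    simp only [AF, hF, Matrix.mul_add, Matrix.mul_sub]
    abel
  have h1 := riccati_feedback (A := c.A) (B := c.B) (H := c.H) hR (isHermitian_conj hH)
    (isUnit_iff_ne_zero.2 hRH) F
  have hKF : F - gain c.A c.B c.R (conj c.H) = K.toRows₂ := add_sub_cancel_right _ _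
  rw [hKF] at h1
  have h2 := second_step_le hR hX hW hle (c.AF F) P
  have h3 := (isTwist_star.posDef_map hW).posSemidef.conjTranspose_mul_mul_same
    (P - conj (c.FX X) * c.AF F)
  have h4 := riccatiMap_le_feedback (A := c.A) (H := c.H) hR (isHermitian_conj hX) hW F
  rw [hT, conj_hatR_mul, hatH_eq c hRdet hRH] at hhat
  -- `h3` restores the square subtracted in `h2`; the intermediate terms in X̄ and ℛ(X) then
  -- telescope.
  convert ((h2.add h3).add h4).add hle using 1
  have hric : c.hatRic X = riccatiMap c.hatA c.hatB c.hatR c.hatH X := rfl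
  have hsplit : c.ric c.H + K.toRows₂ᴴ * c.RX c.H * K.toRows₂ =
    (c.AF F)ᴴ * conj c.H * c.AF F + Fᴴ * c.R * F + c.H := h1.symm
  rw [hric, hatH_eq c hRdet hRH, ← hhat]
  change _ = _ - (P - conj (c.FX X) * c.AF F)ᴴ * conj (c.RX X) * (P - conj (c.FX X) * c.AF F) +
    (P - conj (c.FX X) * c.AF F)ᴴ * conj (c.RX X) * (P - conj (c.FX X) * c.AF F) +
    ((c.AF F)ᴴ * conj X * c.AF F + Fᴴ * c.R * F + c.H - c.ric X) + (c.ric X - X)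
  rw [← sub_eq_zero] at hsplit ⊢
  rw [← hsplit]
  abel

/-- Apply F, then its conjugate at the new state A_F x: the first block is conj(F) A_F, and the
second is the deviation F - F_H. -/
theorem hatF_nonempty {F : Matrix (Fin m) (Fin n) ℂ} (hF : F ∈ c.setF) : c.hatF.Nonempty := by
  refine ⟨fromRows (conj F * c.AF F) (F - c.FX c.H), ?_⟩
  have : c.hatA - c.hatB * fromRows (conj F * c.AF F) (F - c.FX c.H) =
      conj (c.AF F) * c.AF F := by
    have hconj : conj (c.AF F) = conj c.A - conj c.B * conj F := by
      simp only [conj, AF, Matrix.map_sub _ (map_sub (starRingEnd ℂ)), Matrix.map_mul]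
    rw [hatB_mul, hatA_eq, hconj, toRows₁_fromRows, toRows₂_fromRows]
    simp only [AF, Matrix.mul_sub, Matrix.sub_mul, Matrix.mul_assoc]
    abel
  change SpecRadLtOne _
  rw [this]
  exact hF

theorem setT_inter_setP_nonempty (hR : c.R.IsHermitian) (hH : c.H.IsHermitian)
    {X₀ : Matrix (Fin n) (Fin n) ℂ} (hX₀ : X₀.IsHermitian) (hW₀ : (c.RX X₀).PosDef)
    (hle : (c.ric X₀ - X₀).PosSemidef) {F : Matrix (Fin m) (Fin n) ℂ} (hF : F ∈ c.setF) :
    (c.setT ∩ c.setP).Nonempty := by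
  obtain ⟨X, hX, hge, -, hT⟩ := exists_stabilizing isTwist_star hR hH hX₀ hW₀ hle hF
  have hge' : (conj X - conj X₀).PosSemidef := by
    have := isTwist_star.posSemidef_map hge
    rwa [Matrix.map_sub _ (map_sub (starRingEnd ℂ))] at this
  have hW : (c.RX X).PosDef := posDef_weight_of_le hge' hW₀
  have hdom : X ∈ c.dom := ⟨hX, hW.det_pos.ne'⟩
  exact ⟨X, ⟨hdom, hT⟩, hdom, hW⟩

/-- The stabilizing element X is the supersolution from policy improvement; the solution Y is
obtained separately between X₀ and X in the fixed-point argument, and is not claimed to be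
stabilizing. -/
theorem hat_solutions (hR : c.R.IsHermitian) (hRdet : c.R.det ≠ 0) (hH : c.H.IsHermitian)
    (hRH : (c.RX c.H).det ≠ 0) {X₀ : Matrix (Fin n) (Fin n) ℂ} (hX₀ : X₀.IsHermitian)
    (hW₀ : (c.RX X₀).PosDef) (hle : (c.ric X₀ - X₀).PosSemidef)
    {F : Matrix (Fin m ⊕ Fin m) (Fin n) ℂ} (hF : F ∈ c.hatF) :
    (c.hatRicEq ∩ c.hatP).Nonempty ∧ (c.hatT ∩ c.hatP).Nonempty := by
  have hRh := isHermitian_hatR hR hH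
  have hHh : c.hatH.IsHermitian := by
    rw [hatH_eq c hRdet hRH]
    exact isHermitian_riccatiMap hR hH (isHermitian_conj hH) (isUnit_iff_ne_zero.2 hRH)
  have hid : ∀ M : Matrix (Fin n) (Fin n) ℂ, M.map (RingHom.id ℂ) = M := fun M => by
    ext; rfl
  have hWh := posDef_hatRX hR hH hX₀ hW₀ hle
  have hleh := le_hatRic hR hRdet hH hRH hX₀ hW₀ hle
  obtain ⟨X, hX, hge, hsup, hT⟩ := exists_stabilizing (F := F) (A := c.hatA) (B := c.hatB)
    isTwist_id hRh hHh hX₀ (by rw [hid]; exact hWh) (by rw [hid]; exact hleh)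
    (by rw [hid]; exact specRadLtOne_mul_self_iff.2 hF)
  rw [hid] at hsup
  rw [hid, hid] at hT
  have hmem : ∀ {Y : Matrix (Fin n) (Fin n) ℂ}, Y.IsHermitian → (Y - X₀).PosSemidef →
      Y ∈ c.hatP := fun hY h =>
    have hW := posDef_weight_of_le h hWh
    ⟨⟨hY, hW.det_pos.ne'⟩, hW⟩
  obtain ⟨Y, hY, hYge, hYeq⟩ := exists_riccati_fixedPoint hRh hX₀ hWh hleh hge hsup
  exact ⟨⟨Y, ⟨(hmem hY hYge).1, hYeq⟩, hmem hY hYge⟩,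
    X, ⟨(hmem hX hge).1, specRadLtOne_mul_self_iff.1 hT⟩, hmem hX hge⟩

end Coeffs

end ConjRiccati

end

theorem mainTheorem5 {n m : ℕ} (c : ConjRiccati.Coeffs n m)
    (hR : c.R.IsHermitian) (hRdet : c.R.det ≠ 0) (hH : c.H.IsHermitian)
    (hRH : (c.RX c.H).det ≠ 0)
    (hne : (c.ricLe ∩ c.setP).Nonempty) :
    (c.setF.Nonempty ↔ (c.setT ∩ c.setP).Nonempty) ∧
    (c.setF.Nonempty ∨ (c.setT ∩ c.setP).Nonempty →
      (c.hatRicEq ∩ c.hatP).Nonempty ∧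
      (c.hatF.Nonempty ∧ ConjRiccati.Stabilizable c.hatA c.hatB) ∧
      (c.hatT ∩ c.hatP).Nonempty) := by
  obtain ⟨X₀, ⟨⟨hX₀, -⟩, hle⟩, -, hW₀⟩ := hne
  have hback : (c.setT ∩ c.setP).Nonempty → c.setF.Nonempty :=
    fun ⟨X, ⟨_, hT⟩, _⟩ => ⟨c.FX X, hT⟩
  refine ⟨⟨fun ⟨F, hF⟩ => ConjRiccati.Coeffs.setT_inter_setP_nonempty hR hH hX₀ hW₀ hle hF, hback⟩,
    fun h => ?_⟩
  obtain ⟨F, hF⟩ := h.elim id hback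
  obtain ⟨Fh, hFh⟩ := ConjRiccati.Coeffs.hatF_nonempty hF
  obtain ⟨h1, h2⟩ := ConjRiccati.Coeffs.hat_solutions hR hRdet hH hRH hX₀ hW₀ hle hFh
  exact ⟨h1, ⟨⟨Fh, hFh⟩, Fh, hFh⟩, h2⟩
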